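/- Let $(\mathcal X,\mathcal B(\mathcal X))$ be a measurable space with a probability measure $\pi$, let $\Gamma$ be a compact topological space, and let $\{P_\gamma\}_{\gamma\in\Gamma}$ be Markov transition kernels on $\mathcal X$, each of which is $\pi$-invariant, $\pi$-irreducible and aperiodic. Suppose that there are a measurable set $C\subseteq\mathcal X$ with $\pi(C)>0$, a probability measure $\nu$ on $\mathcal X$ and a constant $\delta>0$ such that $$P_\gamma(x,\cdot)\ \ge\ \delta\,\nu(\cdot)\qquad\text{for all }x\in C,\ \gamma\in\Gamma .$$ *Local simultaneous geometric drift.* Suppose that for every $\gamma\in\Gamma$ there are a measurable function $V_\gamma:\mathcal X\to[1,\infty)$, an open neighbourhood $B_\gamma\subseteq\Gamma$ of $\gamma$, and constants $0<\lambda_\gamma<1$, $b_\gamma<\infty$ such that $$P_{\gamma^\star}V_\gamma\ \le\ \lambda_\gamma V_\gamma+b_\gamma I_C\qquad\text{for all }\gamma^\star\in B_\gamma ,$$ and that $\sup_{x\in C}V_\gamma(x)<\infty$ for every $\gamma\in\Gamma$. *Regeneration time.* For $\gamma\in\Gamma$ let $(X_n,Y_n)_{n\ge0}$ be the split chain on $\mathcal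 X\times\{0,1\}$: given $X_n=x$ one has $Y_n=1$ with probability $\delta I_C(x)$ and $Y_n=0$ otherwise; given $Y_{n}=1$ the next state $X_{n+1}$ is drawn from $\nu$, and given $Y_{n}=0$, $X_{n}=x$ it is drawn from $$Q_\gamma(x,\cdot)=\frac{P_\gamma(x,\cdot)-\delta\,\nu(\cdot)I_C(x)}{1-\delta I_C(x)}$$ (if $\delta=1$ and $x\in C$, then $Y_n=1$ almost surely and $Q_\gamma(x,\cdot)$ is not used). Let $T=\inf\{n\ge1: Y_{n-1}=1\}$, and let $\mathbb E_{\nu,\gamma}$ denote expectation for this chain when $X_0\sim\nu$. Let $f:\mathcal X\to\mathbb R$ be a measurable function such that for some $\varepsilon>0$ $$\sup_{x\in\mathcal X}\frac{|f(x)|}{V_\gamma(x)^{1/2-\varepsilon}}<\infty\qquad\text{for all }\gamma\in\Gamma .$$ Then for every $\gamma\in\Gamma$ the time $T$ is almost surely finite, and there is $\eta>0$ such that $$\sup_{\gamma\in\Gamma}\ \mathbb E_{\nu,\gamma}\left|\sum_{j=0}^{T-1}f(X_j)\right|^{2+\eta}<\infty .$$ -/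

import Mathlib

open MeasureTheory ProbabilityTheory
open scoped ENNReal NNReal

namespace AirMCMC

noncomputable section

section SplitChain

variable {X : Type*} [MeasurableSpace X]

/-- One-step minorisation on a measurable set `C`: `P(x, ·) ≥ δ ν(·)` for all `x ∈ C`. -/
structure IsMinorised (P : Kernel X X) (C : Set X) (ν : Measure X) (δ : ℝ≥0) : Prop where
  measurableSet : MeasurableSet C
  le : ∀ x ∈ C, δ • ν ≤ P x

variable {P : Kernel X X} {C : Set X} {ν : Measure X} {δ : ℝ≥0}

theorem IsMinorised.delta_le_one [IsMarkovKernel P] [IsProbabilityMeasure ν]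
    (h : IsMinorised P C ν δ) {x : X} (hx : x ∈ C) : δ ≤ 1 := by
  have h1 := h.le x hx Set.univ
  simp only [Measure.smul_apply, measure_univ] at h1
  have h2 : (δ : ℝ≥0∞) ≤ 1 := by simpa [ENNReal.smul_def] using h1
  exact_mod_cast h2

/-- The residual distribution `Q(x, ·) = (P(x, ·) - δ ν(·) 1_C(x)) / (1 - δ 1_C(x))`.
If `δ = 1` and `x ∈ C`, the quotient is `0 / 0`; the chain then regenerates at `x` with
probability one, the residual distribution is never used there, and its value is set to `ν`. -/
def residualMeasure (P : Kernel X X) (C : Set X) (ν : Measure X) (δ : ℝ≥0) (x : X) :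
    Measure X :=
  open scoped Classical in
  if x ∈ C then (if δ = 1 then ν else (1 - δ)⁻¹ • (P x - δ • ν)) else P x

theorem IsMinorised.measurable_residualMeasure [IsMarkovKernel P] [IsProbabilityMeasure ν]
    (h : IsMinorised P C ν δ) : Measurable (residualMeasure P C ν δ) := by
  classical
  refine Measure.measurable_of_measurable_coe _ fun A hA => ?_
  have hEq : (fun x => residualMeasure P C ν δ x A) = fun x =>
      if x ∈ C then (if δ = 1 then ν A else ((1 - δ)⁻¹ : ℝ≥0) * (P x A - δ * ν A))
      else P x A := by
    funext x
    unfold residualMeasure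
    by_cases hx : x ∈ C
    · by_cases hd : δ = 1
      · simp [hx, hd]
      · simp only [hx, hd, if_true, if_false]
        rw [Measure.smul_apply, Measure.sub_apply hA (h.le x hx)]
        rfl
    · simp [hx]
  rw [hEq]
  refine Measurable.ite h.measurableSet ?_ (P.measurable_coe hA)
  by_cases hd : δ = 1
  · simp [hd]
  · simp only [hd, if_false]
    exact ((P.measurable_coe hA).sub measurable_const).const_mul _

/-- The residual kernel `Q`. -/
def residualKernel [IsMarkovKernel P] [IsProbabilityMeasure ν] (h : IsMinorised P C ν δ) :
    Kernel X X where
  toFun := residualMeasure P C ν δ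
  measurable' := h.measurable_residualMeasure

instance [IsMarkovKernel P] [IsProbabilityMeasure ν] (h : IsMinorised P C ν δ) :
    IsMarkovKernel (residualKernel h) := by
  refine ⟨fun x => ⟨?_⟩⟩
  change residualMeasure P C ν δ x Set.univ = 1
  unfold residualMeasure
  by_cases hx : x ∈ C
  · by_cases hd : δ = 1
    · simp [hx, hd]
    · have hlt : δ < 1 := lt_of_le_of_ne (h.delta_le_one hx) hd
      have hne : (1 - δ : ℝ≥0) ≠ 0 := (tsub_pos_of_lt hlt).ne'
      simp only [hx, hd, if_true, if_false]
      rw [Measure.smul_apply, Measure.sub_apply MeasurableSet.univ (h.le x hx)]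
      simp only [Measure.smul_apply, measure_univ, ENNReal.smul_def, smul_eq_mul, mul_one]
      rw [← ENNReal.coe_one, ← ENNReal.coe_sub, ← ENNReal.coe_mul, inv_mul_cancel₀ hne]
  · simp [hx]

/-- The conditional law of the bell variable `Y_n` given `X_n = x`: it is `true` with probability
`δ 1_C(x)`. -/
def bellKernel (h : IsMinorised P C ν δ) : Kernel X Bool :=
  open scoped Classical in
  Kernel.piecewise h.measurableSet
    (Kernel.const X (δ • Measure.dirac true + (1 - δ) • Measure.dirac false))
    (Kernel.const X (Measure.dirac false))

instance [IsMarkovKernel P] [IsProbabilityMeasure ν] (h : IsMinorised P C ν δ) :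
    IsMarkovKernel (bellKernel h) := by
  classical
  refine ⟨fun x => ⟨?_⟩⟩
  unfold bellKernel
  rw [Kernel.piecewise_apply']
  by_cases hx : x ∈ C
  · simp only [hx, if_true, Kernel.const_apply, Measure.add_apply, Measure.smul_apply,
      measure_univ, ENNReal.smul_def, smul_eq_mul, mul_one]
    rw [← ENNReal.coe_add, add_tsub_cancel_of_le (h.delta_le_one hx), ENNReal.coe_one]
  · simp [hx]

/-- The conditional law of `X_n` given `(X_{n-1}, Y_{n-1})`: it is `ν` if `Y_{n-1} = 1` and
`Q(X_{n-1}, ·)` if `Y_{n-1} = 0`. -/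
def moveKernel [IsMarkovKernel P] [IsProbabilityMeasure ν] (h : IsMinorised P C ν δ) :
    Kernel (X × Bool) X :=
  open scoped Classical in
  Kernel.piecewise (s := (Prod.snd ⁻¹' {true} : Set (X × Bool)))
    (measurable_snd (measurableSet_singleton true))
    (Kernel.const (X × Bool) ν) ((residualKernel h).comap Prod.fst measurable_fst)

instance [IsMarkovKernel P] [IsProbabilityMeasure ν] (h : IsMinorised P C ν δ) :
    IsMarkovKernel (moveKernel h) := by
  classical
  refine ⟨fun p => ⟨?_⟩⟩
  unfold moveKernel
  rw [Kernel.piecewise_apply']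
  by_cases hp : p ∈ (Prod.snd ⁻¹' {true} : Set (X × Bool))
  · simp only [hp, if_true, Kernel.const_apply, measure_univ]
  · simp only [hp, if_false, measure_univ]

/-- The transition kernel of the split chain `(X_n, Y_n)`: first `X_n` is drawn given
`(X_{n-1}, Y_{n-1})`, then `Y_n` is drawn given `X_n`. -/
def splitKernel [IsMarkovKernel P] [IsProbabilityMeasure ν] (h : IsMinorised P C ν δ) :
    Kernel (X × Bool) (X × Bool) :=
  moveKernel h ⊗ₖ (bellKernel h).comap Prod.snd measurable_snd

instance [IsMarkovKernel P] [IsProbabilityMeasure ν] (h : IsMinorised P C ν δ) :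
    IsMarkovKernel (splitKernel h) := by
  unfold splitKernel
  infer_instance

/-- The law of the whole trajectory `((X_n, Y_n))_{n ≥ 0}` of the split chain when `X_0 ∼ ν`. -/
def splitChainLaw [IsMarkovKernel P] [IsProbabilityMeasure ν] (h : IsMinorised P C ν δ) :
    Measure (ℕ → X × Bool) :=
  Kernel.trajMeasure (X := fun _ : ℕ => X × Bool) (ν ⊗ₘ bellKernel h)
    (fun n => (splitKernel h).comap (fun w => w ⟨n, Finset.mem_Iic.2 le_rfl⟩)
      (measurable_pi_apply _))

/-- The regeneration time `T = inf {n ≥ 1 : Y_{n-1} = 1}`, with value `⊤` if there is no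
such `n`. -/
def regenerationTime (ω : ℕ → X × Bool) : ℕ∞ :=
  ⨅ (n : ℕ) (_ : 1 ≤ n ∧ (ω (n - 1)).2 = true), (n : ℕ∞)

/-- The sum `∑_{j=0}^{T-1} f(X_j)` over the first tour of the split chain (used only on
trajectories with `T < ∞`). -/
def tourSum (f : X → ℝ) (ω : ℕ → X × Bool) : ℝ :=
  ∑ j ∈ Finset.range (regenerationTime ω).toNat, f (ω j).1

end SplitChain

section Assumptions

variable {X Γ : Type*} [MeasurableSpace X]

/-- Aperiodicity of a `π`-irreducible kernel with invariant probability `π`: there is no cycle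
`D_0 → D_1 → ⋯ → D_{d-1} → D_0` of `d ≥ 2` disjoint measurable sets whose union has full
`π`-measure. -/
def IsAperiodic (π : Measure X) (P : Kernel X X) : Prop :=
  ∀ d : ℕ, 2 ≤ d → ¬ ∃ D : ZMod d → Set X,
    (∀ i, MeasurableSet (D i)) ∧ Pairwise (fun i j => Disjoint (D i) (D j)) ∧
    (∀ i, ∀ x ∈ D i, P x (D (i + 1)) = 1) ∧ π (⋃ i, D i)ᶜ = 0

/-- Regularity and small set: all kernels are `π`-invariant, `π`-irreducible and aperiodic, and
the simultaneous one-step minorisation condition holds on `C`. -/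
structure RegularSmallSet (P : Γ → Kernel X X) (π : Measure X) (C : Set X) (ν : Measure X)
    (δ : ℝ≥0) : Prop where
  invariant : ∀ γ, (P γ).Invariant π
  irreducible : ∀ γ, (P γ).IsIrreducible π
  aperiodic : ∀ γ, IsAperiodic π (P γ)
  measure_pos : 0 < π C
  delta_pos : 0 < δ
  minorised : ∀ γ, IsMinorised (P γ) C ν δ

/-- Local simultaneous geometric drift, with drift functions `V γ : X → [1, ∞)`: every `γ` has an
open neighbourhood `B` and constants `0 < lam < 1`, `b < ∞` with
`P_{γ'} V_γ ≤ lam V_γ + b 1_C` for all `γ' ∈ B`. -/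
structure LocalGeometricDrift [TopologicalSpace Γ] (P : Γ → Kernel X X) (C : Set X)
    (V : Γ → X → ℝ) : Prop where
  measurable : ∀ γ, Measurable (V γ)
  one_le : ∀ γ x, 1 ≤ V γ x
  drift : ∀ γ, ∃ B : Set Γ, IsOpen B ∧ γ ∈ B ∧ ∃ lam b : ℝ, 0 < lam ∧ lam < 1 ∧
    ∀ γ' ∈ B, ∀ x, ∫⁻ y, ENNReal.ofReal (V γ y) ∂(P γ' x) ≤
      ENNReal.ofReal (lam * V γ x + C.indicator (fun _ => b) x)

/-- The `V`-norm `sup_x |g(x)| / V(x)`, with values in `[0, ∞]`. -/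
def vNorm (V g : X → ℝ) : ℝ≥0∞ := ⨆ x, ENNReal.ofReal (|g x| / V x)

/-- The Lindeberg-type condition: for some `η > 0`,
`sup_γ E_{ν,γ} |∑_{j=0}^{T-1} f(X_j)|^{2+η} < ∞`. That the regeneration time is almost surely
finite, so that the sum makes sense, is part of the condition. -/
def LindebergCondition {P : Γ → Kernel X X} [∀ γ, IsMarkovKernel (P γ)] {C : Set X}
    {ν : Measure X} [IsProbabilityMeasure ν] {δ : ℝ≥0} (h : ∀ γ, IsMinorised (P γ) C ν δ)
    (f : X → ℝ) : Prop :=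
  ∃ η : ℝ, 0 < η ∧
    (∀ γ, ∀ᵐ ω ∂(splitChainLaw (h γ)), regenerationTime ω < ⊤) ∧
    (⨆ γ, ∫⁻ ω, ENNReal.ofReal (|tourSum f ω| ^ (2 + η)) ∂(splitChainLaw (h γ))) < ⊤

end Assumptions

end

end AirMCMC

/-! Kill the chain at its first regeneration. The killed chain moves by `(1 - δ 1_C) Q = P - δ ν
1_C`, and for `W = V + c` with `δ c = |b|` the subtracted mass `δ ν(W) ≥ |b|` on `C` absorbs the
constant of the drift condition. Hence `(1 - δ 1_C) Q W ≤ ρ W` everywhere with some `ρ < 1`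
(`setLIntegral_drift_le`), and iterating gives `E[V(X_n); T > n] ≤ ρ ^ n ν(W)`
(`setLIntegral_noRegeneration_le`).

Since `V ≥ 1`, this shows `T < ∞` almost surely. With `p = 2 + 2 ε` the growth condition gives `|f|
^ p ≤ M V`, so the `L^p` norm of `f(X_n) 1_{T > n}` decays geometrically, and these terms sum to a
finite `L^p` bound on the tour sum (`lintegral_tsum_rpow_le`). The bound depends only on the drift
data, `M`, `p`, `ν` and `δ`, so it is uniform on each neighbourhood of the drift condition; finitely
many of these cover the compact `Γ`. -/

namespace ProbabilityTheory.Kernel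

/-! ### One-step integration along trajectory measures -/

open Preorder

variable {E : ℕ → Type*} [∀ n, MeasurableSpace (E n)]
  {κ : (n : ℕ) → Kernel (Π i : Finset.Iic n, E i) (E (n + 1))} [∀ n, IsMarkovKernel (κ n)]
  {μ₀ : Measure (E 0)}

theorem map_eval_zero_trajMeasure : (trajMeasure μ₀ κ).map (fun ω => ω 0) = μ₀ := by
  have h : (fun ω : Π n, E n => ω 0) =
      (fun w : Π i : Finset.Iic 0, E i => w ⟨0, Finset.mem_Iic.2 le_rfl⟩) ∘ frestrictLe 0 := rfl
  rw [h, ← Measure.map_map (by fun_prop) (by fun_prop), trajMeasure,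
    Measure.map_comp _ _ (by fun_prop), traj_map_frestrictLe, partialTraj_self, Measure.id_comp]
  exact (Measure.map_map (μ := μ₀) (measurable_pi_apply _)
    (MeasurableEquiv.measurable _)).trans Measure.map_id

theorem lintegral_trajMeasure_succ [IsProbabilityMeasure μ₀] (n : ℕ)
    {φ : (Π i : Finset.Iic n, E i) × E (n + 1) → ℝ≥0∞} (hφ : Measurable φ) :
    ∫⁻ ω, φ (frestrictLe n ω, ω (n + 1)) ∂(trajMeasure μ₀ κ) =
      ∫⁻ ω, ∫⁻ z, φ (frestrictLe n ω, z) ∂(κ n (frestrictLe n ω)) ∂(trajMeasure μ₀ κ) := by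
  have h := map_frestrictLe_trajMeasure_compProd_eq_map_trajMeasure (μ₀ := μ₀) (κ := κ) (a := n)
  rw [← MeasureTheory.lintegral_map (f := φ) hφ (g := fun ω : Π n, E n => (frestrictLe n ω, ω (n + 1)))
    (by fun_prop), ← h, Measure.lintegral_compProd hφ,
    MeasureTheory.lintegral_map hφ.lintegral_kernel_prod_right' (by fun_prop)]

end ProbabilityTheory.Kernel

/-! ### Moments of series with geometrically decaying terms -/

namespace ENNReal

/-- Weighted Hölder for finite sums passes to the supremum over finite sets; raising it to the power
`p` turns the exponent `1 - 1/p` into `p - 1`. -/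
theorem rpow_tsum_mul_le {ι : Type*} {p : ℝ} (hp : 1 ≤ p) (w a : ι → ℝ≥0∞) :
    (∑' i, w i * a i) ^ p ≤ (∑' i, w i) ^ (p - 1) * ∑' i, w i * a i ^ p := by
  have hp0 : 0 < p := by linarith
  have h : ∑' i, w i * a i ≤ (∑' i, w i) ^ (1 - p⁻¹) * (∑' i, w i * a i ^ p) ^ p⁻¹ := by
    rw [ENNReal.tsum_eq_iSup_sum]
    refine iSup_le fun s => (ENNReal.inner_le_weight_mul_Lp_of_nonneg s hp w a).trans ?_
    have h0 : 0 ≤ 1 - p⁻¹ := sub_nonneg.2 (inv_le_one_of_one_le₀ hp)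
    gcongr <;> exact ENNReal.sum_le_tsum s
  refine (ENNReal.rpow_le_rpow h hp0.le).trans_eq ?_
  rw [ENNReal.mul_rpow_of_nonneg _ _ hp0.le, ← ENNReal.rpow_mul, ← ENNReal.rpow_mul,
    inv_mul_cancel₀ hp0.ne', ENNReal.rpow_one, sub_mul, one_mul, inv_mul_cancel₀ hp0.ne']

end ENNReal

namespace AirMCMC

/-- If the `p`-th moments of `F j` are at most `D (θ ^ j) ^ p`, then the `p`-th moment of
`∑ F j` is at most `D (∑ θ ^ j) ^ p`. -/
theorem lintegral_tsum_rpow_le {Ω : Type*} [MeasurableSpace Ω] {μ : Measure Ω}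
    {F : ℕ → Ω → ℝ≥0∞} (hF : ∀ j, Measurable (F j)) {p : ℝ} (hp : 1 ≤ p) {D θ : ℝ≥0∞}
    (hθ0 : θ ≠ 0) (hθ : θ ≠ ⊤) (h : ∀ j, ∫⁻ ω, F j ω ^ p ∂μ ≤ D * (θ ^ j) ^ p) :
    ∫⁻ ω, (∑' j, F j ω) ^ p ∂μ ≤
      (∑' j : ℕ, θ ^ j) ^ (p - 1) * (D * ∑' j : ℕ, θ ^ j) := by
  have hp0 : 0 ≤ p := by linarith
  have hw0 (j : ℕ) : θ ^ j ≠ 0 := pow_ne_zero _ hθ0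
  have hw (j : ℕ) : θ ^ j ≠ ⊤ := ENNReal.pow_ne_top hθ
  -- With weights `θ ^ j`, the rescaled terms `(θ ^ j)⁻¹ F j` have `p`-th moments at most `D`, and
  -- the weights are left over to sum the series.
  calc ∫⁻ ω, (∑' j, F j ω) ^ p ∂μ
      = ∫⁻ ω, (∑' j, θ ^ j * ((θ ^ j)⁻¹ * F j ω)) ^ p ∂μ := by
        simp_rw [← mul_assoc, ENNReal.mul_inv_cancel (hw0 _) (hw _), one_mul]
    _ ≤ ∫⁻ ω, (∑' j : ℕ, θ ^ j) ^ (p - 1) *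
          ∑' j, θ ^ j * ((θ ^ j)⁻¹ * F j ω) ^ p ∂μ :=
        lintegral_mono fun ω => ENNReal.rpow_tsum_mul_le hp _ _
    _ = (∑' j : ℕ, θ ^ j) ^ (p - 1) *
          ∑' j, θ ^ j * (((θ ^ j)⁻¹) ^ p * ∫⁻ ω, F j ω ^ p ∂μ) := by
        rw [lintegral_const_mul _ (by fun_prop), lintegral_tsum (by fun_prop)]
        congr 1
        refine tsum_congr fun j => ?_
        simp_rw [ENNReal.mul_rpow_of_nonneg _ _ hp0]
        rw [lintegral_const_mul _ (by fun_prop), lintegral_const_mul _ (by fun_prop)]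
    _ ≤ (∑' j : ℕ, θ ^ j) ^ (p - 1) * (D * ∑' j : ℕ, θ ^ j) := by
        rw [← ENNReal.tsum_mul_left (a := D)]
        refine mul_le_mul_right (ENNReal.tsum_le_tsum fun j => ?_) _
        calc θ ^ j * (((θ ^ j)⁻¹) ^ p * ∫⁻ ω, F j ω ^ p ∂μ)
            ≤ θ ^ j * (((θ ^ j)⁻¹) ^ p * (D * (θ ^ j) ^ p)) := by gcongr; exact h j
          _ = θ ^ j * D * ((θ ^ j)⁻¹ * θ ^ j) ^ p := by
              rw [ENNReal.mul_rpow_of_nonneg _ _ hp0]; ring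
          _ = D * θ ^ j := by
              rw [ENNReal.inv_mul_cancel (hw0 j) (hw j), ENNReal.one_rpow, mul_one, mul_comm]

/-! ### The split chain killed at regeneration -/

section SplitChain

variable {X : Type*}

/-- The trajectories without regeneration before time `n`, that is, with `T > n`. -/
def noRegeneration (X : Type*) (n : ℕ) : Set (ℕ → X × Bool) :=
  {ω | ∀ i < n, (ω i).2 = false}

theorem measurableSet_noRegeneration [MeasurableSpace X] (n : ℕ) : MeasurableSet (noRegeneration X n) := by
  have : noRegeneration X n = ⋂ i, ⋂ _ : i < n, {ω | (ω i).2 = false} := by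
    ext; simp [noRegeneration]
  rw [this]
  exact MeasurableSet.iInter fun i => MeasurableSet.iInter fun _ =>
    measurableSet_eq_fun (by fun_prop) measurable_const

theorem noRegeneration_succ_subset (n : ℕ) : noRegeneration X (n + 1) ⊆ noRegeneration X n :=
  fun _ h i hi => h i (hi.trans n.lt_succ_self)

theorem mem_noRegeneration_of_lt {ω : ℕ → X × Bool} {n : ℕ} (h : (n : ℕ∞) < regenerationTime ω) :
    ω ∈ noRegeneration X n := by
  intro i hi
  by_contra hne
  have h1 : regenerationTime ω ≤ ((i + 1 : ℕ) : ℕ∞) :=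
    iInf₂_le (i + 1) ⟨Nat.le_add_left 1 i, by simpa using hne⟩
  have h2 : ((i + 1 : ℕ) : ℕ∞) ≤ n := by exact_mod_cast hi
  exact absurd (h.trans_le (h1.trans h2)) (lt_irrefl _)

/-- Trades the random range of summation for the events `T > j`. No finiteness of `T` is needed:
`toNat` sends `⊤` to `0`, making the tour sum empty. -/
theorem ofReal_abs_tourSum_le (f : X → ℝ) (ω : ℕ → X × Bool) :
    ENNReal.ofReal |tourSum f ω| ≤
      ∑' j, (noRegeneration X j).indicator (fun ω => ENNReal.ofReal |f (ω j).1|) ω := by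
  have h1 : ENNReal.ofReal |tourSum f ω| ≤
      ∑ j ∈ Finset.range (regenerationTime ω).toNat, ENNReal.ofReal |f (ω j).1| := by
    rw [← ENNReal.ofReal_sum_of_nonneg fun _ _ => abs_nonneg _]
    exact ENNReal.ofReal_le_ofReal (Finset.abs_sum_le_sum_abs _ _)
  refine h1.trans (le_trans (Finset.sum_le_sum fun j hj => ?_) (ENNReal.sum_le_tsum _))
  rw [Set.indicator_of_mem]
  refine mem_noRegeneration_of_lt (lt_of_lt_of_le ?_ (ENat.natCast_toNat_le_self _))
  exact_mod_cast Finset.mem_range.1 hj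

variable [MeasurableSpace X] {P : Kernel X X} {C : Set X} {ν : Measure X} {δ : ℝ≥0}

/-- If `P` satisfies the minorisation condition on `C ∋ x`, then `ν(W) < ∞` whenever
`P W (x) < ∞`. -/
theorem IsMinorised.lintegral_lt_top (h : IsMinorised P C ν δ) (hδ : 0 < δ) {x : X} (hx : x ∈ C)
    {W : X → ℝ≥0∞} (hW : ∫⁻ y, W y ∂(P x) < ⊤) : ∫⁻ y, W y ∂ν < ⊤ := by
  have hle := lintegral_mono' (h.le x hx) (le_refl W)
  rw [ENNReal.smul_def, lintegral_smul_measure] at hle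
  exact ENNReal.lt_top_of_mul_ne_top_right (hle.trans_lt hW).ne (by exact_mod_cast hδ.ne')

-- The killing factor: integrating out the bell on the event that it does not ring.
open scoped Classical in
theorem lintegral_bellKernel_ite (h : IsMinorised P C ν δ) (x : X) (u : ℝ≥0∞) :
    ∫⁻ b, (if b = false then u else 0) ∂(bellKernel h x) =
      (if x ∈ C then ((1 - δ : ℝ≥0) : ℝ≥0∞) else 1) * u := by
  unfold bellKernel
  rw [Kernel.piecewise_apply]
  by_cases hx : x ∈ C
  · simp only [hx, if_true, Kernel.const_apply]
    rw [ENNReal.smul_def, ENNReal.smul_def, lintegral_add_measure, lintegral_smul_measure,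
      lintegral_smul_measure, lintegral_dirac, lintegral_dirac]
    simp
  · simp [hx]

variable [IsMarkovKernel P] [IsProbabilityMeasure ν]

theorem lintegral_splitChainLaw_zero (h : IsMinorised P C ν δ) {g : X × Bool → ℝ≥0∞}
    (hg : Measurable g) :
    ∫⁻ ω, g (ω 0) ∂(splitChainLaw h) = ∫⁻ x, ∫⁻ y, g (x, y) ∂(bellKernel h x) ∂ν := by
  have hmap : (splitChainLaw h).map (fun ω => ω 0) = ν ⊗ₘ bellKernel h :=
    Kernel.map_eval_zero_trajMeasure
  rw [← Measure.lintegral_compProd hg, ← hmap, lintegral_map hg (by fun_prop)]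

/-- The Markov property. It applies because `T > n + 1` is decided by the bells up to time `n`. -/
theorem setLIntegral_splitChainLaw_succ (h : IsMinorised P C ν δ) {g : X × Bool → ℝ≥0∞}
    (hg : Measurable g) (n : ℕ) :
    ∫⁻ ω in noRegeneration X (n + 1), g (ω (n + 1)) ∂(splitChainLaw h) =
      ∫⁻ ω in noRegeneration X (n + 1), ∫⁻ z, g z ∂(splitKernel h (ω n))
        ∂(splitChainLaw h) := by
  set S : Set (Finset.Iic n → X × Bool) := {w | ∀ i, (w i).2 = false}
  have hS : MeasurableSet S := by
    have : S = ⋂ i, {w | (w i).2 = false} := by ext; simp [S]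
    rw [this]
    exact MeasurableSet.iInter fun i => measurableSet_eq_fun (by fun_prop) measurable_const
  have hpre : noRegeneration X (n + 1) = Preorder.frestrictLe (π := fun _ => X × Bool) n ⁻¹' S := by
    ext ω
    simp [noRegeneration, S]
  have hφ : Measurable fun q : (Finset.Iic n → X × Bool) × (X × Bool) =>
      S.indicator 1 q.1 * g q.2 :=
    ((measurable_one.indicator hS).comp measurable_fst).mul (hg.comp measurable_snd)
  have key := Kernel.lintegral_trajMeasure_succ (E := fun _ : ℕ => X × Bool)
    (μ₀ := ν ⊗ₘ bellKernel h)
    (κ := fun n => (splitKernel h).comap (fun w => w ⟨n, Finset.mem_Iic.2 le_rfl⟩)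
      (measurable_pi_apply _)) n hφ
  rw [← lintegral_indicator (measurableSet_noRegeneration _),
    ← lintegral_indicator (measurableSet_noRegeneration _)]
  have e1 (G : (ℕ → X × Bool) → ℝ≥0∞) (ω : ℕ → X × Bool) :
      (noRegeneration X (n + 1)).indicator G ω =
        S.indicator 1 (Preorder.frestrictLe (π := fun _ => X × Bool) n ω) * G ω := by
    rw [hpre]
    by_cases hω : Preorder.frestrictLe (π := fun _ => X × Bool) n ω ∈ S
    · rw [Set.indicator_of_mem (by exact hω), Set.indicator_of_mem hω, Pi.one_apply, one_mul]
    · rw [Set.indicator_of_notMem (by exact hω), Set.indicator_of_notMem hω, zero_mul]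
  simp_rw [e1]
  refine Eq.trans key (lintegral_congr fun ω => ?_)
  exact lintegral_const_mul (μ := splitKernel h (ω n))
    (S.indicator 1 (Preorder.frestrictLe (π := fun _ => X × Bool) n ω)) hg

theorem lintegral_splitKernel_false (h : IsMinorised P C ν δ) {g : X × Bool → ℝ≥0∞}
    (hg : Measurable g) (x : X) :
    ∫⁻ z, g z ∂(splitKernel h (x, false)) =
      ∫⁻ y, ∫⁻ b, g (y, b) ∂(bellKernel h y) ∂(residualKernel h x) := by
  unfold splitKernel
  rw [Kernel.lintegral_compProd _ _ _ hg]
  have : moveKernel h (x, false) = residualKernel h x := by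
    classical
    unfold moveKernel
    rw [Kernel.piecewise_apply]
    simp [Kernel.comap_apply]
  rw [this]
  rfl

open scoped Classical in
/-- If `(1 - δ 1_C) Q W ≤ ρ W`, then `E[W(X_n); T > n] ≤ ρ ^ n ν(W)`. -/
theorem setLIntegral_noRegeneration_le (h : IsMinorised P C ν δ) {W : X → ℝ≥0∞}
    (hW : Measurable W) {ρ : ℝ≥0∞}
    (hd : ∀ x, (if x ∈ C then ((1 - δ : ℝ≥0) : ℝ≥0∞) else 1) *
      ∫⁻ y, W y ∂(residualKernel h x) ≤ ρ * W x) (n : ℕ) :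
    ∫⁻ ω in noRegeneration X n, W (ω n).1 ∂(splitChainLaw h) ≤ ρ ^ n * ∫⁻ x, W x ∂ν := by
  set QW : X → ℝ≥0∞ := fun x => ∫⁻ y, W y ∂(residualKernel h x)
  have hQW : Measurable QW := hW.lintegral_kernel
  -- The induction runs on `H`, not on `W`: integrating `H` over the bell at `x` produces exactly
  -- the left side of `hd`, so each step gains a factor `ρ`.
  set H : X × Bool → ℝ≥0∞ := fun q => if q.2 = false then QW q.1 else 0
  have hH : Measurable H := Measurable.ite
    (measurable_snd (measurableSet_singleton false)) (hQW.comp measurable_fst) measurable_const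
  have hbell (x : X) : ∫⁻ b, H (x, b) ∂(bellKernel h x) ≤ ρ * W x := by
    exact (lintegral_bellKernel_ite h x (QW x)).trans_le (hd x)
  have hlast {n : ℕ} {ω : ℕ → X × Bool} (hω : ω ∈ noRegeneration X (n + 1)) :
      ω n = ((ω n).1, false) := Prod.ext rfl (hω n n.lt_succ_self)
  have hu (n : ℕ) : ∫⁻ ω in noRegeneration X n, H (ω n) ∂(splitChainLaw h) ≤
      ρ ^ (n + 1) * ∫⁻ x, W x ∂ν := by
    induction n with
    | zero =>
      calc ∫⁻ ω in noRegeneration X 0, H (ω 0) ∂(splitChainLaw h)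
          ≤ ∫⁻ ω, H (ω 0) ∂(splitChainLaw h) := setLIntegral_le_lintegral _ _
        _ = ∫⁻ x, ∫⁻ y, H (x, y) ∂(bellKernel h x) ∂ν := lintegral_splitChainLaw_zero h hH
        _ ≤ ∫⁻ x, ρ * W x ∂ν := lintegral_mono hbell
        _ = ρ ^ (0 + 1) * ∫⁻ x, W x ∂ν := by rw [lintegral_const_mul _ hW, zero_add, pow_one]
    | succ n ih =>
      calc ∫⁻ ω in noRegeneration X (n + 1), H (ω (n + 1)) ∂(splitChainLaw h)
          = ∫⁻ ω in noRegeneration X (n + 1), ∫⁻ z, H z ∂(splitKernel h (ω n))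
              ∂(splitChainLaw h) := setLIntegral_splitChainLaw_succ h hH n
        _ ≤ ∫⁻ ω in noRegeneration X (n + 1), ρ * H (ω n) ∂(splitChainLaw h) := by
            refine setLIntegral_mono (by fun_prop) fun ω hω => ?_
            rw [hlast hω, lintegral_splitKernel_false h hH]
            calc ∫⁻ y, ∫⁻ b, H (y, b) ∂(bellKernel h y) ∂(residualKernel h (ω n).1)
                ≤ ∫⁻ y, ρ * W y ∂(residualKernel h (ω n).1) := lintegral_mono hbell
              _ = ρ * QW (ω n).1 := lintegral_const_mul _ hW
              _ = ρ * H ((ω n).1, false) := by simp [H]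
        _ ≤ ∫⁻ ω in noRegeneration X n, ρ * H (ω n) ∂(splitChainLaw h) :=
            lintegral_mono_set (noRegeneration_succ_subset n)
        _ = ρ * ∫⁻ ω in noRegeneration X n, H (ω n) ∂(splitChainLaw h) :=
            lintegral_const_mul _ (by fun_prop)
        _ ≤ ρ * (ρ ^ (n + 1) * ∫⁻ x, W x ∂ν) := by gcongr
        _ = ρ ^ (n + 1 + 1) * ∫⁻ x, W x ∂ν := by ring
  cases n with
  | zero =>
    refine (setLIntegral_le_lintegral _ _).trans ?_
    rw [lintegral_splitChainLaw_zero h (g := fun q => W q.1) (by fun_prop)]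
    simp_rw [lintegral_const, measure_univ, mul_one]
    simp
  | succ n =>
    calc ∫⁻ ω in noRegeneration X (n + 1), W (ω (n + 1)).1 ∂(splitChainLaw h)
        = ∫⁻ ω in noRegeneration X (n + 1), ∫⁻ z, W z.1 ∂(splitKernel h (ω n))
            ∂(splitChainLaw h) :=
          setLIntegral_splitChainLaw_succ h (g := fun q => W q.1) (by fun_prop) n
      _ ≤ ∫⁻ ω in noRegeneration X (n + 1), H (ω n) ∂(splitChainLaw h) := by
          refine setLIntegral_mono (by fun_prop) fun ω hω => ?_
          rw [hlast hω, lintegral_splitKernel_false h (g := fun q => W q.1) (by fun_prop)]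
          simp_rw [lintegral_const, measure_univ, mul_one]
          simp [H, QW]
      _ ≤ ∫⁻ ω in noRegeneration X n, H (ω n) ∂(splitChainLaw h) :=
          lintegral_mono_set (noRegeneration_succ_subset n)
      _ ≤ ρ ^ (n + 1) * ∫⁻ x, W x ∂ν := hu n

open scoped Classical in
/-- `(1 - δ 1_C) Q W + δ ν(W) 1_C ≤ P W`. -/
theorem residualKernel_decomposition_le (h : IsMinorised P C ν δ) (W : X → ℝ≥0∞) (x : X) :
    (if x ∈ C then ((1 - δ : ℝ≥0) : ℝ≥0∞) else 1) * ∫⁻ y, W y ∂(residualKernel h x) +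
      (if x ∈ C then δ * ∫⁻ y, W y ∂ν else 0) ≤ ∫⁻ y, W y ∂(P x) := by
  change _ * ∫⁻ y, W y ∂(residualMeasure P C ν δ x) + _ ≤ _
  unfold residualMeasure
  by_cases hx : x ∈ C
  · have hle : δ * ∫⁻ y, W y ∂ν ≤ ∫⁻ y, W y ∂(P x) := by
      have := lintegral_mono' (h.le x hx) (le_refl W)
      rwa [ENNReal.smul_def, lintegral_smul_measure] at this
    -- For `δ = 1` the killing factor vanishes on `C`, so the conventional value of the residual
    -- measure plays no role.
    by_cases hd : δ = 1
    · simpa [hx, hd] using hle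
    · have hne : (1 - δ : ℝ≥0) ≠ 0 :=
        (tsub_pos_of_lt (lt_of_le_of_ne (h.delta_le_one hx) hd)).ne'
      have e1 : ∫⁻ y, W y ∂((1 - δ)⁻¹ • (P x - δ • ν)) =
          ((1 - δ)⁻¹ : ℝ≥0) * ∫⁻ y, W y ∂(P x - δ • ν) := by
        rw [ENNReal.smul_def, lintegral_smul_measure]; rfl
      have e2 : ∫⁻ y, W y ∂(P x) = ∫⁻ y, W y ∂(P x - δ • ν) + δ * ∫⁻ y, W y ∂ν := by
        conv_lhs => rw [← Measure.sub_add_cancel_of_le (h.le x hx)]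
        rw [lintegral_add_measure, ENNReal.smul_def δ ν, lintegral_smul_measure]; rfl
      simp only [hx, hd, if_true, if_false]
      rw [e1, e2, ← mul_assoc, ← ENNReal.coe_mul, mul_inv_cancel₀ hne, ENNReal.coe_one, one_mul]
  · simp [hx]

/-- A drift condition for `P` and a minorisation on `C` give a function `W ≥ V` with
`E[W(X_n); T > n] ≤ ρ ^ n ν(W)`; the constants do not depend on `P`. -/
theorem setLIntegral_drift_le (h : IsMinorised P C ν δ) (hδ : 0 < δ) {V : X → ℝ}
    (hV : Measurable V) (hV1 : ∀ x, 1 ≤ V x) {lam b : ℝ} (hlam0 : 0 < lam) (hlam1 : lam < 1)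
    (hd : ∀ x, ∫⁻ y, ENNReal.ofReal (V y) ∂(P x) ≤
      ENNReal.ofReal (lam * V x + C.indicator (fun _ => b) x)) (n : ℕ) :
    ∫⁻ ω in noRegeneration X n, ENNReal.ofReal (V (ω n).1) ∂(splitChainLaw h) ≤
      ENNReal.ofReal ((lam + |b| / δ) / (1 + |b| / δ)) ^ n *
        ∫⁻ x, ENNReal.ofReal (V x + |b| / δ) ∂ν := by
  classical
  have hδ' : (0 : ℝ) < δ := by exact_mod_cast hδ
  set c : ℝ := |b| / δ
  have hc : 0 ≤ c := by positivity
  have hρ0 : 0 ≤ (lam + c) / (1 + c) := by positivity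
  -- The ratio `(lam v + c) / (v + c)` is nonincreasing in `v` because `lam < 1`, so on `v ≥ 1` its
  -- maximum is its value at `v = 1`.
  have hρ (x : X) : lam * V x + c ≤ (lam + c) / (1 + c) * (V x + c) := by
    rw [div_mul_eq_mul_div, le_div_iff₀ (by positivity)]
    nlinarith [mul_nonneg hc (mul_nonneg (sub_nonneg.2 hlam1.le) (sub_nonneg.2 (hV1 x)))]
  have hPW (x : X) : ∫⁻ y, ENNReal.ofReal (V y + c) ∂(P x) ≤
      ENNReal.ofReal (lam * V x + c) + (if x ∈ C then ENNReal.ofReal |b| else 0) := by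
    have hV0 : 0 ≤ lam * V x := mul_nonneg hlam0.le (by linarith [hV1 x])
    calc ∫⁻ y, ENNReal.ofReal (V y + c) ∂(P x)
        = ∫⁻ y, ENNReal.ofReal (V y) ∂(P x) + ENNReal.ofReal c := by
          simp_rw [fun y => ENNReal.ofReal_add (zero_le_one.trans (hV1 y)) hc]
          rw [lintegral_add_right _ measurable_const]
          simp
      _ ≤ ENNReal.ofReal (lam * V x + C.indicator (fun _ => |b|) x) + ENNReal.ofReal c := by
          gcongr
          refine (hd x).trans (ENNReal.ofReal_le_ofReal ?_)
          gcongr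
          exact le_abs_self b
      _ = _ := by
          by_cases hx : x ∈ C
          · simp only [hx, Set.indicator_of_mem, if_true]
            rw [ENNReal.ofReal_add hV0 (abs_nonneg b), ENNReal.ofReal_add hV0 hc]
            ring
          · simp only [hx, Set.indicator_of_notMem, if_false, not_false_eq_true, add_zero]
            rw [ENNReal.ofReal_add hV0 hc]
  have hνW : ENNReal.ofReal |b| ≤ δ * ∫⁻ y, ENNReal.ofReal (V y + c) ∂ν := by
    calc ENNReal.ofReal |b| = δ * ∫⁻ _, ENNReal.ofReal c ∂ν := by
          rw [lintegral_const, measure_univ, mul_one, ← ENNReal.ofReal_coe_nnreal,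
            ← ENNReal.ofReal_mul hδ'.le, mul_div_cancel₀ _ hδ'.ne']
      _ ≤ _ := by
          gcongr with y
          linarith [hV1 y]
  have hdrift (x : X) : (if x ∈ C then ((1 - δ : ℝ≥0) : ℝ≥0∞) else 1) *
      ∫⁻ y, ENNReal.ofReal (V y + c) ∂(residualKernel h x) ≤
      ENNReal.ofReal ((lam + c) / (1 + c)) * ENNReal.ofReal (V x + c) := by
    have h1 := (residualKernel_decomposition_le h (fun y => ENNReal.ofReal (V y + c)) x).trans
      (hPW x)
    rw [← ENNReal.ofReal_mul hρ0]
    refine le_trans ?_ (ENNReal.ofReal_le_ofReal (hρ x))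
    by_cases hx : x ∈ C
    · simp only [hx, if_true] at h1 ⊢
      -- On `C`, the regeneration mass `δ ν(W) ≥ |b|` on the left cancels the drift constant on the
      -- right.
      refine (ENNReal.add_le_add_iff_right (ENNReal.ofReal_ne_top (r := |b|))).1 ?_
      exact (add_le_add le_rfl hνW).trans h1
    · simpa [hx] using h1
  refine le_trans ?_ (setLIntegral_noRegeneration_le h (W := fun x => ENNReal.ofReal (V x + c))
    (by fun_prop) hdrift n)
  gcongr
  linarith

/-! ### Finiteness of the regeneration time and moments of tour sums -/

theorem ae_regenerationTime_lt_top (h : IsMinorised P C ν δ) {K ρ : ℝ≥0∞} (hK : K < ⊤)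
    (hρ : ρ < 1) (hb : ∀ n, splitChainLaw h (noRegeneration X n) ≤ ρ ^ n * K) :
    ∀ᵐ ω ∂(splitChainLaw h), regenerationTime ω < ⊤ := by
  rw [ae_iff]
  have hle (n : ℕ) : splitChainLaw h {ω | ¬ regenerationTime ω < ⊤} ≤ ρ ^ n * K := by
    refine le_trans (measure_mono fun ω hω => mem_noRegeneration_of_lt ?_) (hb n)
    rw [not_lt_top_iff.1 hω]
    exact ENat.natCast_lt_top n
  have hlim : Filter.Tendsto (fun n : ℕ => ρ ^ n * K) Filter.atTop (nhds 0) := by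
    simpa using ENNReal.Tendsto.mul_const (ENNReal.tendsto_pow_atTop_nhds_zero_of_lt_one hρ)
      (Or.inr hK.ne)
  exact le_antisymm (ge_of_tendsto' hlim hle) zero_le

theorem lintegral_tourSum_rpow_le (h : IsMinorised P C ν δ) {f : X → ℝ} (hf : Measurable f)
    {p : ℝ} (hp : 1 ≤ p) {D θ : ℝ≥0∞} (hθ0 : θ ≠ 0) (hθ : θ ≠ ⊤)
    (hb : ∀ n, ∫⁻ ω in noRegeneration X n, ENNReal.ofReal (|f (ω n).1| ^ p) ∂(splitChainLaw h) ≤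
      D * (θ ^ n) ^ p) :
    ∫⁻ ω, ENNReal.ofReal (|tourSum f ω| ^ p) ∂(splitChainLaw h) ≤
      (∑' j : ℕ, θ ^ j) ^ (p - 1) * (D * ∑' j : ℕ, θ ^ j) := by
  have hp0 : 0 < p := by linarith
  refine le_trans (lintegral_mono fun ω => ?_) (lintegral_tsum_rpow_le
    (F := fun j => (noRegeneration X j).indicator fun ω => ENNReal.ofReal |f (ω j).1|)
    (fun j => Measurable.indicator (by fun_prop) (measurableSet_noRegeneration j)) hp hθ0 hθ
    fun j => ?_)
  · rw [← ENNReal.ofReal_rpow_of_nonneg (abs_nonneg _) hp0.le]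
    exact ENNReal.rpow_le_rpow (ofReal_abs_tourSum_le f ω) hp0.le
  · refine le_trans (le_of_eq ?_) (hb j)
    rw [← lintegral_indicator (measurableSet_noRegeneration j)]
    refine lintegral_congr fun ω => ?_
    by_cases hω : ω ∈ noRegeneration X j
    · simp only [Set.indicator_of_mem hω]
      rw [ENNReal.ofReal_rpow_of_nonneg (abs_nonneg _) hp0.le]
    · simp only [Set.indicator_of_notMem hω, ENNReal.zero_rpow_of_pos hp0]

end SplitChain

/-- The exponent works since `(1/2 - ε)(2 + 2 ε) = 1 - ε - 2 ε² ≤ 1` and `V ≥ 1`; this is what fixes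
`η = 2 ε`. -/
theorem abs_rpow_le_of_vNorm_lt_top {X : Type*} {V f : X → ℝ} (hV1 : ∀ x, 1 ≤ V x) {ε : ℝ}
    (hε : 0 < ε) (hfV : vNorm (fun x => V x ^ (1 / 2 - ε)) f < ⊤) :
    ∃ M : ℝ, 0 ≤ M ∧ ∀ x, |f x| ^ (2 + 2 * ε) ≤ M * V x := by
  set N := vNorm (fun x => V x ^ (1 / 2 - ε)) f
  refine ⟨N.toReal ^ (2 + 2 * ε), by positivity, fun x => ?_⟩
  have hV0 : 0 < V x := by linarith [hV1 x]
  have h1 : |f x| / V x ^ (1 / 2 - ε) ≤ N.toReal :=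
    (ENNReal.ofReal_le_iff_le_toReal hfV.ne).1
      (le_iSup (fun x => ENNReal.ofReal (|f x| / V x ^ (1 / 2 - ε))) x)
  rw [div_le_iff₀ (by positivity)] at h1
  calc |f x| ^ (2 + 2 * ε) ≤ (N.toReal * V x ^ (1 / 2 - ε)) ^ (2 + 2 * ε) := by gcongr
    _ = N.toReal ^ (2 + 2 * ε) * V x ^ ((1 / 2 - ε) * (2 + 2 * ε)) := by
        rw [Real.mul_rpow (by positivity) (by positivity), Real.rpow_mul hV0.le]
    _ ≤ N.toReal ^ (2 + 2 * ε) * V x ^ (1 : ℝ) := by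
        gcongr
        · exact hV1 x
        · nlinarith
    _ = N.toReal ^ (2 + 2 * ε) * V x := by rw [Real.rpow_one]

/-- Under minorisation and drift, the regeneration time is almost surely finite and tour sums have
finite `p`-th moments, locally uniformly in the parameter. -/
theorem exists_lintegral_tourSum_le {X Γ : Type*} [MeasurableSpace X] {P : Γ → Kernel X X}
    [∀ γ, IsMarkovKernel (P γ)] {C : Set X} (hC : C.Nonempty) {ν : Measure X}
    [IsProbabilityMeasure ν] {δ : ℝ≥0} (hδ : 0 < δ) (h : ∀ γ, IsMinorised (P γ) C ν δ)
    {V : X → ℝ} (hV : Measurable V) (hV1 : ∀ x, 1 ≤ V x) {lam b : ℝ} (hlam0 : 0 < lam)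
    (hlam1 : lam < 1) {B : Set Γ}
    (hd : ∀ γ ∈ B, ∀ x, ∫⁻ y, ENNReal.ofReal (V y) ∂(P γ x) ≤
      ENNReal.ofReal (lam * V x + C.indicator (fun _ => b) x))
    {f : X → ℝ} (hf : Measurable f) {p M : ℝ} (hp : 1 ≤ p) (hM : 0 ≤ M)
    (hfV : ∀ x, |f x| ^ p ≤ M * V x) :
    ∃ K < (⊤ : ℝ≥0∞), ∀ γ ∈ B, (∀ᵐ ω ∂(splitChainLaw (h γ)), regenerationTime ω < ⊤) ∧
      ∫⁻ ω, ENNReal.ofReal (|tourSum f ω| ^ p) ∂(splitChainLaw (h γ)) ≤ K := by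
  obtain ⟨x₀, hx₀⟩ := hC
  rcases B.eq_empty_or_nonempty with rfl | ⟨γ₀, hγ₀⟩
  · exact ⟨0, ENNReal.zero_lt_top, by simp⟩
  have hp0 : 0 < p := by linarith
  have hδ' : (0 : ℝ) < δ := by exact_mod_cast hδ
  set c : ℝ := |b| / δ
  have hc : 0 ≤ c := by positivity
  set ρ : ℝ := (lam + c) / (1 + c)
  have hρ0 : 0 < ρ := by positivity
  have hρ1 : ρ < 1 := by
    rw [div_lt_one (by positivity)]
    linarith
  set K : ℝ≥0∞ := ∫⁻ x, ENNReal.ofReal (V x + c) ∂ν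
  have hK : K < ⊤ := by
    -- A single parameter `γ₀ ∈ B` and a single point of `C` suffice: there `δ ν(V) ≤ P V < ∞`. The
    -- resulting `K` does not involve `γ`.
    have hνV : ∫⁻ x, ENNReal.ofReal (V x) ∂ν < ⊤ :=
      (h γ₀).lintegral_lt_top hδ hx₀ ((hd γ₀ hγ₀ x₀).trans_lt ENNReal.ofReal_lt_top)
    calc K = ∫⁻ x, ENNReal.ofReal (V x) ∂ν + ENNReal.ofReal c := by
          simp_rw [K, fun y => ENNReal.ofReal_add (zero_le_one.trans (hV1 y)) hc]
          rw [lintegral_add_right _ measurable_const]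
          simp
      _ < ⊤ := ENNReal.add_lt_top.2 ⟨hνV, ENNReal.ofReal_lt_top⟩
  have hgeom (γ : Γ) (hγ : γ ∈ B) (n : ℕ) :
      ∫⁻ ω in noRegeneration X n, ENNReal.ofReal (V (ω n).1) ∂(splitChainLaw (h γ)) ≤
        ENNReal.ofReal ρ ^ n * K :=
    setLIntegral_drift_le (h γ) hδ hV hV1 hlam0 hlam1 (hd γ hγ) n
  -- The decay rate in `L^p` norm that corresponds to the rate `ρ` for `p`-th moments.
  set θ : ℝ≥0∞ := ENNReal.ofReal ρ ^ p⁻¹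
  have hρ1' : ENNReal.ofReal ρ < 1 := by simpa using hρ1
  have hρ0' : 0 < ENNReal.ofReal ρ := by simpa using hρ0
  have hθ0 : θ ≠ 0 := (ENNReal.rpow_pos hρ0' ENNReal.ofReal_ne_top).ne'
  have hθ1 : θ < 1 := ENNReal.rpow_lt_one hρ1' (inv_pos.2 hp0)
  have hθρ (n : ℕ) : (θ ^ n) ^ p = ENNReal.ofReal ρ ^ n := by
    rw [← ENNReal.rpow_natCast, ← ENNReal.rpow_mul, ← ENNReal.rpow_mul, ← ENNReal.rpow_natCast]
    congr 1
    field_simp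
  have hsum : ∑' j : ℕ, θ ^ j < ⊤ := by
    rw [ENNReal.tsum_geometric, ENNReal.inv_lt_top]
    exact tsub_pos_of_lt hθ1
  refine ⟨(∑' j : ℕ, θ ^ j) ^ (p - 1) * (ENNReal.ofReal M * K * ∑' j : ℕ, θ ^ j),
    ENNReal.mul_lt_top (ENNReal.rpow_lt_top_of_nonneg (by linarith) hsum.ne)
      (ENNReal.mul_lt_top (ENNReal.mul_lt_top ENNReal.ofReal_lt_top hK) hsum), fun γ hγ =>
    ⟨ae_regenerationTime_lt_top (h γ) hK hρ1' fun n => ?_,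
      lintegral_tourSum_rpow_le (h γ) hf hp hθ0 hθ1.ne_top fun n => ?_⟩⟩
  · refine le_trans ?_ (hgeom γ hγ n)
    rw [← setLIntegral_one]
    refine lintegral_mono fun ω => ?_
    simpa using hV1 (ω n).1
  · calc ∫⁻ ω in noRegeneration X n, ENNReal.ofReal (|f (ω n).1| ^ p) ∂(splitChainLaw (h γ))
        ≤ ∫⁻ ω in noRegeneration X n, ENNReal.ofReal M * ENNReal.ofReal (V (ω n).1)
            ∂(splitChainLaw (h γ)) := by
          refine lintegral_mono fun ω => ?_
          rw [← ENNReal.ofReal_mul hM]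
          exact ENNReal.ofReal_le_ofReal (hfV _)
      _ = ENNReal.ofReal M *
            ∫⁻ ω in noRegeneration X n, ENNReal.ofReal (V (ω n).1) ∂(splitChainLaw (h γ)) :=
          lintegral_const_mul _ (by fun_prop)
      _ ≤ ENNReal.ofReal M * (ENNReal.ofReal ρ ^ n * K) := by gcongr; exact hgeom γ hγ n
      _ = ENNReal.ofReal M * K * (θ ^ n) ^ p := by rw [hθρ]; ring

end AirMCMC

/-! ### From local to global bounds by compactness -/

theorem mainTheorem9 {X Γ : Type*} [MeasurableSpace X] [TopologicalSpace Γ] [CompactSpace Γ]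
    (P : Γ → Kernel X X) [∀ γ, IsMarkovKernel (P γ)]
    (π : Measure X) [IsProbabilityMeasure π]
    (C : Set X) (ν : Measure X) [IsProbabilityMeasure ν] (δ : ℝ≥0)
    (hreg : AirMCMC.RegularSmallSet P π C ν δ)
    (V : Γ → X → ℝ) (hdrift : AirMCMC.LocalGeometricDrift P C V)
    (hVC : ∀ γ, BddAbove (V γ '' C))
    (f : X → ℝ) (hf : Measurable f)
    (hfV : ∃ ε : ℝ, 0 < ε ∧
      ∀ γ, AirMCMC.vNorm (fun x => V γ x ^ (1 / 2 - ε)) f < ⊤) :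
    AirMCMC.LindebergCondition hreg.minorised f := by
  obtain ⟨ε, hε, hfV⟩ := hfV
  have hC : C.Nonempty := nonempty_of_measure_ne_zero hreg.measure_pos.ne'
  have hloc (γ : Γ) : ∃ B : Set Γ, IsOpen B ∧ γ ∈ B ∧ ∃ K < (⊤ : ℝ≥0∞), ∀ γ' ∈ B,
      (∀ᵐ ω ∂(AirMCMC.splitChainLaw (hreg.minorised γ')), AirMCMC.regenerationTime ω < ⊤) ∧
      ∫⁻ ω, ENNReal.ofReal (|AirMCMC.tourSum f ω| ^ (2 + 2 * ε))
        ∂(AirMCMC.splitChainLaw (hreg.minorised γ')) ≤ K := by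
    obtain ⟨B, hB, hγB, lam, b, hlam0, hlam1, hd⟩ := hdrift.drift γ
    obtain ⟨M, hM, hfM⟩ := AirMCMC.abs_rpow_le_of_vNorm_lt_top (hdrift.one_le γ) hε (hfV γ)
    exact ⟨B, hB, hγB, AirMCMC.exists_lintegral_tourSum_le hC hreg.delta_pos hreg.minorised
      (hdrift.measurable γ) (hdrift.one_le γ) hlam0 hlam1 hd hf (by linarith) hM hfM⟩
  refine ⟨2 * ε, by positivity, fun γ => ?_, ?_⟩
  · obtain ⟨B, -, hγB, K, -, hK⟩ := hloc γ
    exact (hK γ hγB).1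
  · choose B hB hγB K hKtop hK using hloc
    obtain ⟨t, ht⟩ := isCompact_univ.elim_finite_subcover B hB
      fun γ _ => Set.mem_iUnion.2 ⟨γ, hγB γ⟩
    -- The sum of the finitely many local bounds dominates each of them and stands in for their
    -- maximum.
    refine lt_of_le_of_lt (b := ∑ γ ∈ t, K γ) (iSup_le fun γ => ?_)
      (ENNReal.sum_lt_top.2 fun γ _ => hKtop γ)
    obtain ⟨γ₀, hγ₀, hγ⟩ := Set.mem_iUnion₂.1 (ht (Set.mem_univ γ))
    exact (hK γ₀ γ hγ).2.trans (Finset.single_le_sum (fun _ _ => zero_le) hγ₀)
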